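/- For $\sigma\in\mathbb R$ let $\mathbb C_\sigma=\{s\in\mathbb C:\operatorname{Re}s>\sigma\}$. Let $\mathcal D$ be the vector space of Dirichlet series $\sum_{n\ge1}a_nn^{-s}$ with complex coefficients that converge at some point of $\mathbb C$, and let $\mathcal H_+$ be the space of those Dirichlet series $\sum_{n\ge1} a_nn^{-s}$ for which $\sum_{n\ge1}|a_n|^2n^{-2/k}<\infty$ for every $k\in\mathbb N$, $k\ge1$ (that is, for which every translated series $\sum a_nn^{-1/k}n^{-s}$ belongs to the Hardy space $\mathcal H^2$); every series in $\mathcal H_+$ converges on $\mathbb C_{1/2}$. Let $\theta\in\mathbb R$ and let $\phi:\mathbb C_\theta\to\mathbb C_{1/2}$ be an arbitrary function. We say that $\phi$ defines a composition operator $C_\phi:\mathcal H_+\to\mathcal D$ if there is a linear map $C_\phi:\mathcal H_+\to\mathcal D$ such that for every $D\in\mathcal H_+$ there is $\sigma\ge\theta$ such that $C_\phi(D)$ converges on $\mathbb C_\sigma$ and $C_\phi(D)(s)=D(\phi(s))$ for all $s\in\mathbb C_\sigma$. Theorem. The function $\phi$ defines a composition operator $C_\phi:\mathcal H_+\to\mathcal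 D$ if and only if there is $\mu\ge\theta$ such that $\phi$ is analytic on $\mathbb C_\mu$ and there are $c_0\in\mathbb N\cup\{0\}$ and a Dirichlet series $\varphi\in\mathcal D$ that converges on $\mathbb C_\mu$ with $$\phi(s)=c_0s+\varphi(s)\qquad\text{for all }s\in\mathbb C_\mu .$$ -/

import Mathlib

open Filter Topology

noncomputable section

namespace DirichletSeries

/-- The open half-plane `ℂ_σ = {s : Re s > σ}`. -/
def halfPlane (σ : ℝ) : Set ℂ := {s | σ < s.re}

/-- The Dirichlet series `∑_{n ≥ 1} a n * n ^ (-s)` converges (possibly only conditionally, i.e. in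
the sense of its ordered partial sums) at the point `s`, with sum `v`. -/
def HasSumAt (a : ℕ → ℂ) (s v : ℂ) : Prop :=
  Tendsto (fun N : ℕ => ∑ n ∈ Finset.Icc 1 N, a n * (n : ℂ) ^ (-s)) atTop (𝓝 v)

theorem HasSumAt.add {a b : ℕ → ℂ} {s v w : ℂ} (ha : HasSumAt a s v) (hb : HasSumAt b s w) :
    HasSumAt (a + b) s (v + w) := by
  have := Tendsto.add ha hb
  simpa only [HasSumAt, Pi.add_apply, add_mul, Finset.sum_add_distrib] using this

theorem HasSumAt.smul {a : ℕ → ℂ} {s v : ℂ} (c : ℂ) (ha : HasSumAt a s v) :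
    HasSumAt (c • a) s (c * v) := by
  have := Tendsto.const_mul c ha
  simpa only [HasSumAt, Pi.smul_apply, smul_eq_mul, mul_assoc, Finset.mul_sum] using this

theorem sum_Icc_eq (a : ℕ → ℂ) (s : ℂ) (N : ℕ) :
    ∑ n ∈ Finset.Icc 1 N, a n * (n : ℂ) ^ (-s) = ∑ n ∈ Finset.range (N + 1), LSeries.term a s n := by
  rw [Finset.sum_range_succ', LSeries.term_zero, add_zero, Finset.range_eq_Ico,
    Finset.sum_Ico_add' (fun n => LSeries.term a s n) 0 N 1]
  refine Finset.sum_congr (by ext; simp) fun n hn => ?_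
  have : n ≠ 0 := by
    have := (Finset.mem_Ico.mp hn).1
    omega
  rw [LSeries.term_of_ne_zero this, Complex.cpow_neg, div_eq_mul_inv]

theorem hasSumAt_of_summable {a : ℕ → ℂ} {s : ℂ} (h : LSeriesSummable a s) :
    HasSumAt a s (LSeries a s) := by
  have := (h.hasSum.tendsto_sum_nat).comp (tendsto_add_atTop_nat 1)
  simpa only [HasSumAt, sum_Icc_eq, Function.comp_def, LSeries] using this

theorem HasSumAt.summable {a : ℕ → ℂ} {s v : ℂ} (h : HasSumAt a s v) {w : ℂ}
    (hw : s.re + 1 < w.re) : LSeriesSummable a w := by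
  have h1 : Tendsto (fun N => ∑ n ∈ Finset.range (N + 1), LSeries.term a s n) atTop (𝓝 v) := by
    simpa only [HasSumAt, sum_Icc_eq] using h
  have h2 := (tendsto_add_atTop_iff_nat
    (f := fun N => ∑ n ∈ Finset.range N, LSeries.term a s n) 1).mp h1
  have h3 : Tendsto (fun N => LSeries.term a s N) atTop (𝓝 0) := by
    have := h1.sub h2
    simpa [Finset.sum_range_succ] using this
  obtain ⟨C, hC⟩ := (h3.norm.bddAbove_range)
  refine LSeriesSummable_of_le_const_mul_rpow (x := s.re + 1) hw ⟨C, fun n hn => ?_⟩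
  have h4 : ‖LSeries.term a s n‖ ≤ C := hC ⟨n, rfl⟩
  have hp : (0 : ℝ) < (n : ℝ) ^ s.re := Real.rpow_pos_of_pos (by positivity) _
  rw [LSeries.term_of_ne_zero hn, norm_div,
    Complex.norm_natCast_cpow_of_pos (Nat.pos_of_ne_zero hn), div_le_iff₀ hp] at h4
  simpa using h4

/-- The space `𝒟` of Dirichlet series that converge at some point. A Dirichlet series is given by
its coefficients `a n`, `n ≥ 1`; the unused entry `a 0` is normalised to be zero. -/
def D : Submodule ℂ (ℕ → ℂ) where
  carrier := {a | a 0 = 0 ∧ ∃ s v : ℂ, HasSumAt a s v}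
  zero_mem' := ⟨rfl, 0, 0, by simp [HasSumAt]⟩
  add_mem' := by
    rintro a b ⟨ha0, s, v, ha⟩ ⟨hb0, t, w, hb⟩
    refine ⟨by simp [ha0, hb0], ((max s.re t.re + 2 : ℝ) : ℂ), _,
      (hasSumAt_of_summable (ha.summable ?_)).add (hasSumAt_of_summable (hb.summable ?_))⟩
    · rw [Complex.ofReal_re]; linarith [le_max_left s.re t.re]
    · rw [Complex.ofReal_re]; linarith [le_max_right s.re t.re]
  smul_mem' := by
    rintro c a ⟨ha0, s, v, ha⟩
    exact ⟨by simp [ha0], s, _, ha.smul c⟩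

/-- The Hardy space `ℋ²` of Dirichlet series with square-summable coefficients. -/
def H2 : Submodule ℂ (ℕ → ℂ) where
  carrier := {a | a 0 = 0 ∧ Memℓp a 2}
  zero_mem' := ⟨rfl, zero_memℓp⟩
  add_mem' := fun ha hb => ⟨by simp [ha.1, hb.1], ha.2.add hb.2⟩
  smul_mem' := fun c _ ha => ⟨by simp [ha.1], ha.2.const_smul c⟩

/-- The coefficients of the translated series `∑ (a n / n ^ σ) n ^ (-s)`. -/
def translate (σ : ℝ) : (ℕ → ℂ) →ₗ[ℂ] (ℕ → ℂ) where
  toFun a n := a n * (n : ℂ) ^ (-(σ : ℂ))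
  map_add' a b := by ext n; simp [add_mul]
  map_smul' c a := by ext n; simp [mul_assoc]

/-- The space `ℋ₊` of Dirichlet series all of whose translates by `1 / k`, `k = 1, 2, …`, belong to
`ℋ²`. -/
def HPlus : Submodule ℂ (ℕ → ℂ) where
  carrier := {a | a 0 = 0 ∧ ∀ k : ℕ, 1 ≤ k → translate (1 / (k : ℝ)) a ∈ H2}
  zero_mem' := ⟨rfl, fun k _ => by rw [map_zero]; exact H2.zero_mem⟩
  add_mem' := fun ha hb =>
    ⟨by simp [ha.1, hb.1], fun k hk => by rw [map_add]; exact H2.add_mem (ha.2 k hk) (hb.2 k hk)⟩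
  smul_mem' := fun c _ ha =>
    ⟨by simp [ha.1], fun k hk => by rw [map_smul]; exact H2.smul_mem c (ha.2 k hk)⟩

/-- `φ : ℂ_θ → ℂ_{1/2}` defines a composition operator `C_φ : ℋ₊ → 𝒟`: there is a linear map `C`
such that, for every `a ∈ ℋ₊`, the series `C a ∈ 𝒟` represents `s ↦ ∑ a n * n ^ (-φ s)` on some
half-plane contained in `ℂ_θ` (which may depend on `a`). -/
def DefinesCompositionOperator (θ : ℝ) (φ : ℂ → ℂ) : Prop :=
  ∃ C : HPlus →ₗ[ℂ] D, ∀ a : HPlus, ∃ σ : ℝ, θ ≤ σ ∧ ∀ s ∈ halfPlane σ,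
    ∃ v : ℂ, HasSumAt (a : ℕ → ℂ) (φ s) v ∧ HasSumAt (C a : ℕ → ℂ) s v

end DirichletSeries

end

namespace DirichletSeries

/-! Necessity. The image of `n ^ (-s)` is a Dirichlet series for `n ^ (-φ)`, with a first nonzero
index `m_n`. Growth along the real axis makes `log m_n / log n` a constant `κ`. All `n ^ κ` are then
integers, so `κ` is a natural number `c` (`exists_nat_eq_of_rpow_mem_nat`). Far to the right, the
logarithm of the normalised series writes `φ - c s` as an absolutely convergent general Dirichlet
series with frequencies `log (k / n ^ (c j))`, up to an integer multiple of `2πi / log n` that may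
depend on `s`, since `φ` is arbitrary. Comparing `n = 2` with `n = 3` makes these multiples
constant, because `log 2` and `log 3` are linearly independent over `ℚ`
(`exists_eq_add_zsmul_of_isPreconnected`). Uniqueness of coefficients (`coeff_eq_of_hasSum_eq`)
leaves only frequencies common to both expansions; by coprimality these are logarithms of integers,
so the series is an ordinary one.

Sufficiency. Let `a` be the coefficients of `φ - c s`. Far to the right, `φ` is `c s + a 1` plus an
expansion of small norm `N`, so `n ^ (-φ)` has an expansion of norm `n ^ (-X)` with `X = Re (a 1) +
c τ - N`. If `X > 1/2`, the expansions of `b n * n ^ (-φ)` can be summed for every `b ∈ ℋ₊`. For `c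
= 0` this needs `Re (a 1) > 1/2`, which follows from the range of `φ` (`lt_re_coeff_one`). -/

/-! ### Integer-valued powers and other preliminaries -/

/-- If the functions `F 0, F 1, …` are successive derivatives on `(0, ∞)` and `F 0` takes integer
values at positive integers, then `F k` takes an integer value beyond any positive integer. -/
theorem exists_intValue_of_hasDerivAt (k : ℕ) : ∀ (F : ℕ → ℝ → ℝ),
    (∀ i x, 0 < x → HasDerivAt (F i) (F (i + 1) x) x) →
    (∀ n : ℕ, 0 < n → ∃ z : ℤ, F 0 n = z) →
    ∀ n : ℕ, 0 < n → ∃ ξ : ℝ, (n : ℝ) ≤ ξ ∧ ∃ z : ℤ, F k ξ = z := by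
  induction k with
  | zero => exact fun F _ h0 n hn => ⟨n, le_rfl, h0 n hn⟩
  | succ k ih =>
    intro F hF h0 n hn
    -- Induct on the unit difference, which is again integer-valued at integers; the mean value
    -- theorem then turns a difference of `F k` into a value of `F (k + 1)`.
    obtain ⟨ξ, hξ, z, hz⟩ := ih (fun i x => F i (x + 1) - F i x)
      (fun i x hx => ((hF i (x + 1) (by linarith)).comp_add_const x 1).sub (hF i x hx))
      (fun n hn => by
        obtain ⟨z, hz⟩ := h0 n hn
        obtain ⟨w, hw⟩ := h0 (n + 1) (by omega)
        refine ⟨w - z, ?_⟩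
        push_cast at hw ⊢
        rw [hw, hz]) n hn
    have hn' : (0 : ℝ) < n := by exact_mod_cast hn
    obtain ⟨η, hη, hd⟩ := exists_hasDerivAt_eq_slope (F k) (F (k + 1)) (lt_add_one ξ)
      (fun x hx => (hF k x (by linarith [hx.1])).continuousAt.continuousWithinAt)
      (fun x hx => hF k x (by linarith [hx.1]))
    refine ⟨η, by linarith [hη.1], z, ?_⟩
    rw [hd, ← hz]
    simp

/-- A real exponent `κ` for which `n ^ κ` is an integer for all `n ≥ 1` is a natural
number. -/
theorem exists_nat_eq_of_rpow_mem_nat {κ : ℝ}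
    (h : ∀ n : ℕ, 0 < n → ∃ m : ℕ, (n : ℝ) ^ κ = m) : ∃ c : ℕ, κ = c := by
  set P : ℕ → ℝ := fun k => ∏ i ∈ Finset.range k, (κ - i)
  set k := ⌊κ⌋₊ + 1
  have hk : κ < k := by simpa [k] using Nat.lt_floor_add_one κ
  have key := exists_intValue_of_hasDerivAt k (fun i x => P i * x ^ (κ - i)) (fun i x hx => by
      have := (Real.hasDerivAt_rpow_const (p := κ - i) (Or.inl hx.ne')).const_mul (P i)
      convert! this using 1
      simp only [P, Finset.prod_range_succ]
      push_cast
      rw [← sub_sub, mul_assoc]) (fun n hn => by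
        obtain ⟨m, hm⟩ := h n hn
        exact ⟨m, by simp [P, hm]⟩)
  -- Since `k > κ`, the `k`-th derivative of `x ^ κ` tends to zero. Its integer values far out must
  -- vanish, which forces a factor `κ - i` of `P k` to be zero.
  have hlim : Tendsto (fun x : ℝ => P k * x ^ (κ - k)) atTop (𝓝 0) := by
    have := (tendsto_rpow_neg_atTop (y := k - κ) (by linarith)).const_mul (P k)
    simpa using this
  obtain ⟨X, hX⟩ := eventually_atTop.mp ((Metric.tendsto_nhds.mp hlim) 1 one_pos)
  obtain ⟨n, hn⟩ := exists_nat_gt (max X 0)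
  have hn0 : (0 : ℝ) < n := (le_max_right _ _).trans_lt hn
  obtain ⟨ξ, hξ, z, hz⟩ := key n (by exact_mod_cast hn0)
  have hξ0 : 0 < ξ := by linarith
  have h1 := hX ξ (by linarith [le_max_left X 0])
  rw [hz, dist_zero_right, Int.norm_cast_real, Int.norm_eq_abs] at h1
  have h2 : z = 0 := by
    rw [← Int.abs_lt_one_iff]; exact_mod_cast h1
  rw [h2, Int.cast_zero, mul_eq_zero] at hz
  obtain hz | hz := hz
  · obtain ⟨i, -, hi⟩ := Finset.prod_eq_zero_iff.mp hz
    exact ⟨i, by linarith⟩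
  · exact absurd hz (Real.rpow_pos_of_pos hξ0 _).ne'

theorem eq_zero_of_tendsto_mul_id {u L : ℝ} (h : Tendsto (fun x : ℝ => u * x) atTop (𝓝 L)) :
    u = 0 := by
  have h1 := h.mul tendsto_inv_atTop_zero
  rw [mul_zero] at h1
  refine tendsto_nhds_unique (tendsto_const_nhds.congr' ?_) h1
  filter_upwards [eventually_gt_atTop 0] with x hx
  field_simp

/-- If `f` differs from the continuous functions `g` and `h` by integer multiples of the
independent periods `a` and `b`, then the multiples are constant. -/
theorem exists_eq_add_zsmul_of_isPreconnected {X : Set ℂ} (hX : IsPreconnected X)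
    {f g h : ℂ → ℂ} (hg : ContinuousOn g X) (hh : ContinuousOn h X) {a b : ℂ}
    (hab : ∀ k l : ℤ, k * a = l * b → k = 0)
    (hfg : ∀ s ∈ X, ∃ k : ℤ, f s = g s + k * a) (hfh : ∀ s ∈ X, ∃ k : ℤ, f s = h s + k * b) :
    ∃ k : ℤ, ∀ s ∈ X, f s = g s + k * a := by
  obtain rfl | ⟨s₀, hs₀⟩ := X.eq_empty_or_nonempty
  · exact ⟨0, by simp⟩
  have hcount : (Set.range fun p : ℤ × ℤ => (p.1 : ℂ) * a - p.2 * b).Countable :=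
    Set.countable_range _
  -- `h - g` is continuous with values in a countable set, hence constant on `X`.
  have hsub := hcount.isTotallyDisconnected ((fun s => h s - g s) '' X) (by
    rintro _ ⟨s, hs, rfl⟩
    obtain ⟨k, hk⟩ := hfg s hs
    obtain ⟨l, hl⟩ := hfh s hs
    exact ⟨(k, l), by simp only; linear_combination hl - hk⟩) (hX.image _ (hh.sub hg))
  obtain ⟨k₀, hk₀⟩ := hfg s₀ hs₀
  obtain ⟨l₀, hl₀⟩ := hfh s₀ hs₀
  refine ⟨k₀, fun s hs => ?_⟩
  obtain ⟨k, hk⟩ := hfg s hs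
  obtain ⟨l, hl⟩ := hfh s hs
  have heq : h s - g s = h s₀ - g s₀ := hsub ⟨s, hs, rfl⟩ ⟨s₀, hs₀, rfl⟩
  have := hab (k - k₀) (l - l₀) (by push_cast; linear_combination hl - hk - hl₀ + hk₀ + heq)
  rw [hk, show k = k₀ by omega]

/-- The Dirichlet series in `ℋ₊` converge absolutely on `ℂ_{1/2}`. -/
theorem summable_norm_mul_rpow_of_mem_HPlus {a : ℕ → ℂ} (ha : a ∈ HPlus) {x : ℝ}
    (hx : 1 / 2 < x) : Summable fun n : ℕ => ‖a n‖ * (n : ℝ) ^ (-x) := by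
  obtain ⟨k, hk⟩ := exists_nat_one_div_lt (sub_pos.mpr hx)
  set y : ℝ := 1 / ((k + 1 : ℕ) : ℝ)
  have hy : y < x - 1 / 2 := by simpa [y] using hk
  have h1 : Summable fun n : ℕ => (‖a n‖ * (n : ℝ) ^ (-y)) ^ 2 := by
    have := (memℓp_gen_iff (by norm_num)).mp (ha.2 (k + 1) (by omega)).2
    refine this.congr fun n => ?_
    obtain rfl | hn := Nat.eq_zero_or_pos n
    · simp [ha.1, translate]
    · have : ‖(n : ℂ) ^ (-(y : ℂ))‖ = (n : ℝ) ^ (-y) := by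
        rw [Complex.norm_natCast_cpow_of_pos hn]; simp
      simp only [translate, LinearMap.coe_mk, AddHom.coe_mk, norm_mul]
      rw [this]
      simp
  have h2 : Summable fun n : ℕ => ((n : ℝ) ^ (y - x)) ^ 2 := by
    refine (Real.summable_nat_rpow.mpr (show (y - x) * 2 < -1 by linarith)).congr fun n => ?_
    rw [Real.rpow_mul (by positivity)]
    norm_cast
  refine (h1.add h2).of_nonneg_of_le (fun n => by positivity) fun n => ?_
  obtain rfl | hn := Nat.eq_zero_or_pos n
  · simp only [ha.1, norm_zero, zero_mul]; positivity
  · have : (n : ℝ) ^ (-x) = (n : ℝ) ^ (-y) * (n : ℝ) ^ (y - x) := by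
      rw [← Real.rpow_add (by exact_mod_cast hn)]; ring_nf
    -- Here `u v ≤ u ^ 2 + v ^ 2` splits the term into a square-summable translate and `n ^ (2 (y -
    -- x))`, whose exponent is below `-1`.
    rw [this, ← mul_assoc]
    nlinarith [sq_nonneg (‖a n‖ * (n : ℝ) ^ (-y) - (n : ℝ) ^ (y - x)),
      sq_nonneg (‖a n‖ * (n : ℝ) ^ (-y)), sq_nonneg ((n : ℝ) ^ (y - x))]

/-! ### Calculus of absolutely convergent general Dirichlet series -/

/-- On the closed half-plane `Re s ≥ σ`, the function `f` is the sum of an absolutely convergent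
general Dirichlet series `∑ c i * exp (-(l i) * s)` with frequencies in `S`, and the sum of the
moduli of its terms at `σ` is `M`. Frequencies may be repeated. -/
def HasExpansion (S : Set ℝ) (σ : ℝ) (f : ℂ → ℂ) (M : ℝ) : Prop :=
  ∃ (ι : Type) (l : ι → ℝ) (c : ι → ℂ), (∀ i, l i ∈ S) ∧
    HasSum (fun i => ‖c i‖ * Real.exp (-(l i * σ))) M ∧
    ∀ s : ℂ, σ ≤ s.re → HasSum (fun i => c i * Complex.exp (-(l i * s))) (f s)

theorem hasSum_congr {ι E : Type*} [AddCommMonoid E] [TopologicalSpace E] {f g : ι → E} {a : E}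
    (h : ∀ i, f i = g i) : HasSum f a ↔ HasSum g a := by
  rw [funext h]

theorem norm_mul_exp_eq (c : ℂ) (l : ℝ) (s : ℂ) :
    ‖c * Complex.exp (-(l * s))‖ = ‖c‖ * Real.exp (-(l * s.re)) := by
  simp [Complex.norm_exp]

theorem norm_mul_exp_le (c : ℂ) {l σ : ℝ} (hl : 0 ≤ l) {s : ℂ} (hs : σ ≤ s.re) :
    ‖c * Complex.exp (-(l * s))‖ ≤ ‖c‖ * Real.exp (-(l * σ)) := by
  rw [norm_mul_exp_eq]
  gcongr

namespace HasExpansion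

variable {S T : Set ℝ} {σ : ℝ} {f g : ℂ → ℂ} {M N : ℝ}

theorem congr (h : HasExpansion S σ f M) (hfg : ∀ s : ℂ, σ ≤ s.re → g s = f s) :
    HasExpansion S σ g M := by
  obtain ⟨ι, l, c, hl, hM, hf⟩ := h
  exact ⟨ι, l, c, hl, hM, fun s hs => hfg s hs ▸ hf s hs⟩

theorem mono_freq (h : HasExpansion S σ f M) (hST : S ⊆ T) : HasExpansion T σ f M := by
  obtain ⟨ι, l, c, hl, hM, hf⟩ := h
  exact ⟨ι, l, c, fun i => hST (hl i), hM, hf⟩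

theorem nonneg (h : HasExpansion S σ f M) : 0 ≤ M := by
  obtain ⟨ι, l, c, hl, hM, hf⟩ := h
  exact hM.nonneg fun i => by positivity

theorem norm_le (h : HasExpansion S σ f M) (hS : ∀ x ∈ S, 0 ≤ x) {s : ℂ} (hs : σ ≤ s.re) :
    ‖f s‖ ≤ M := by
  obtain ⟨ι, l, c, hl, hM, hf⟩ := h
  rw [← (hf s hs).tsum_eq]
  exact tsum_of_norm_bounded hM fun i => norm_mul_exp_le _ (hS _ (hl i)) hs

theorem continuousOn (h : HasExpansion S σ f M) (hS : ∀ x ∈ S, 0 ≤ x) :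
    ContinuousOn f {s | σ ≤ s.re} := by
  obtain ⟨ι, l, c, hl, hM, hf⟩ := h
  refine ContinuousOn.congr (continuousOn_tsum (f := fun i s => c i * Complex.exp (-(l i * s)))
    (fun i => by fun_prop) hM.summable fun i s hs => norm_mul_exp_le _ (hS _ (hl i)) hs)
    fun s hs => ((hf s hs).tsum_eq).symm

/-- Moving to the right decreases the norm exponentially if the frequencies are at least `δ`. -/
theorem exists_mono {δ τ : ℝ} (h : HasExpansion S σ f M) (hS : ∀ x ∈ S, δ ≤ x) (hτ : σ ≤ τ) :
    ∃ N ≤ Real.exp (-(δ * (τ - σ))) * M, HasExpansion S τ f N := by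
  obtain ⟨ι, l, c, hl, hM, hf⟩ := h
  have hle : ∀ i, ‖c i‖ * Real.exp (-(l i * τ)) ≤
      Real.exp (-(δ * (τ - σ))) * (‖c i‖ * Real.exp (-(l i * σ))) := fun i => by
    rw [mul_left_comm, ← Real.exp_add]
    gcongr
    nlinarith [mul_le_mul_of_nonneg_right (hS _ (hl i)) (sub_nonneg.mpr hτ)]
  have hM' := hM.mul_left (Real.exp (-(δ * (τ - σ))))
  have hs := hM'.summable.of_nonneg_of_le (fun i => by positivity) hle
  exact ⟨_, hasSum_le hle hs.hasSum hM', ι, l, c, hl, hs.hasSum,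
    fun s h' => hf s (hτ.trans h')⟩

theorem term {x : ℝ} (hx : x ∈ S) (c : ℂ) :
    HasExpansion S σ (fun s => c * Complex.exp (-(x * s))) (‖c‖ * Real.exp (-(x * σ))) :=
  ⟨Unit, fun _ => x, fun _ => c, fun _ => hx, hasSum_unique _, fun _ _ => hasSum_unique _⟩

theorem const (h0 : (0 : ℝ) ∈ S) (c : ℂ) : HasExpansion S σ (fun _ => c) ‖c‖ := by
  simpa using term (σ := σ) h0 c

/-- The norms control the double series absolutely, so it can be flattened over a sigma type;
allowing repeated frequencies avoids any regrouping here. -/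
theorem hasSum {J : Type} {F : J → ℂ → ℂ} {K : J → ℝ} (hS : ∀ x ∈ S, 0 ≤ x)
    (hF : ∀ j, HasExpansion S σ (F j) (K j)) (hK : HasSum K M)
    (hf : ∀ s : ℂ, σ ≤ s.re → HasSum (fun j => F j s) (f s)) : HasExpansion S σ f M := by
  choose ι l c hl hM hF using hF
  have hsum : HasSum (fun p : Σ j, ι j => ‖c p.1 p.2‖ * Real.exp (-(l p.1 p.2 * σ))) M := by
    have h1 : Summable (fun p : Σ j, ι j => ‖c p.1 p.2‖ * Real.exp (-(l p.1 p.2 * σ))) := by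
      refine (summable_sigma_of_nonneg fun p => by positivity).mpr ⟨fun j => (hM j).summable, ?_⟩
      exact hK.summable.congr fun j => (hM j).tsum_eq.symm
    exact HasSum.sigma_of_hasSum hK hM h1
  refine ⟨Σ j, ι j, fun p => l p.1 p.2, fun p => c p.1 p.2, fun p => hl _ _, hsum, fun s hs => ?_⟩
  exact HasSum.sigma_of_hasSum (hf s hs) (fun j => hF j s hs) (Summable.of_norm_bounded hsum.summable
    fun p => norm_mul_exp_le _ (hS _ (hl _ _)) hs)

theorem add (hS : ∀ x ∈ S, 0 ≤ x) (hf : HasExpansion S σ f M) (hg : HasExpansion S σ g N) :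
    HasExpansion S σ (fun s => f s + g s) (M + N) := by
  refine hasSum (J := Bool) (F := fun b => bif b then f else g) (K := fun b => bif b then M else N)
    hS (Bool.forall_bool.mpr ⟨hg, hf⟩) ?_ fun s _ => ?_
  · simpa using hasSum_fintype (fun b => bif b then M else N)
  · simpa using hasSum_fintype (fun b => (bif b then f else g) s)

theorem mul {S : AddSubmonoid ℝ} (hS : ∀ x ∈ S, 0 ≤ x) (hf : HasExpansion S σ f M)
    (hg : HasExpansion S σ g N) : HasExpansion S σ (fun s => f s * g s) (M * N) := by
  obtain ⟨ι, l, c, hl, hM, hf⟩ := hf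
  obtain ⟨κ, l', c', hl', hN, hg⟩ := hg
  have hsum : HasSum (fun p : ι × κ => ‖c p.1 * c' p.2‖ * Real.exp (-((l p.1 + l' p.2) * σ)))
      (M * N) := by
    have h1 : Summable fun p : ι × κ => ‖c p.1‖ * Real.exp (-(l p.1 * σ)) *
        (‖c' p.2‖ * Real.exp (-(l' p.2 * σ))) :=
      hM.summable.mul_of_nonneg hN.summable
        (fun i => mul_nonneg (norm_nonneg _) (Real.exp_nonneg _))
        (fun i => mul_nonneg (norm_nonneg _) (Real.exp_nonneg _))
    refine (hasSum_congr fun p => ?_).mp (HasSum.mul hM hN h1)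
    rw [norm_mul, add_mul, neg_add, Real.exp_add]
    ring
  refine ⟨ι × κ, fun p => l p.1 + l' p.2, fun p => c p.1 * c' p.2,
    fun p => S.add_mem (hl _) (hl' _), hsum, fun s hs => ?_⟩
  have heq : ∀ p : ι × κ, c p.1 * Complex.exp (-(l p.1 * s)) *
      (c' p.2 * Complex.exp (-(l' p.2 * s))) =
      c p.1 * c' p.2 * Complex.exp (-(((l p.1 + l' p.2 : ℝ) : ℂ) * s)) := fun p => by
    push_cast
    rw [add_mul, neg_add, Complex.exp_add]
    ring
  have hs' : Summable fun p : ι × κ => c p.1 * Complex.exp (-(l p.1 * s)) *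
      (c' p.2 * Complex.exp (-(l' p.2 * s))) :=
    Summable.of_norm_bounded hsum.summable fun p => by
      rw [heq p]
      exact norm_mul_exp_le (c p.1 * c' p.2) (hS _ (S.add_mem (hl p.1) (hl' p.2))) hs
  have h2 := HasSum.mul (hf s hs) (hg s hs) hs'
  exact (hasSum_congr heq).mp h2

theorem const_mul {S : AddSubmonoid ℝ} (hS : ∀ x ∈ S, 0 ≤ x) (hf : HasExpansion S σ f M) (c : ℂ) :
    HasExpansion S σ (fun s => c * f s) (‖c‖ * M) :=
  (const S.zero_mem c).mul hS hf

theorem pow {S : AddSubmonoid ℝ} (hS : ∀ x ∈ S, 0 ≤ x) (hf : HasExpansion S σ f M) (k : ℕ) :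
    HasExpansion S σ (fun s => f s ^ k) (M ^ k) := by
  induction k with
  | zero => simpa using const (σ := σ) S.zero_mem (1 : ℂ)
  | succ k ih => simpa only [pow_succ] using ih.mul hS hf

/-- The exponential series has positive coefficients, so the same series evaluated at `M` sums the
norms. -/
theorem cexp {S : AddSubmonoid ℝ} (hS : ∀ x ∈ S, 0 ≤ x) (hf : HasExpansion S σ f M) :
    HasExpansion S σ (fun s => Complex.exp (f s)) (Real.exp M) := by
  refine hasSum (F := fun k s => ((k.factorial : ℂ)⁻¹) * f s ^ k)
    (K := fun k => ‖(k.factorial : ℂ)⁻¹‖ * M ^ k) hS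
    (fun k => (hf.pow hS k).const_mul hS _) ?_ fun s _ => ?_
  · have := NormedSpace.expSeries_div_hasSum_exp (𝔸 := ℝ) M
    rw [← Real.exp_eq_exp_ℝ] at this
    exact (hasSum_congr fun k => by simp [div_eq_inv_mul]).mp this
  · have := NormedSpace.expSeries_div_hasSum_exp (𝔸 := ℂ) (f s)
    rw [← Complex.exp_eq_exp_ℂ] at this
    exact (hasSum_congr fun k => by rw [div_eq_inv_mul]).mp this

theorem clog {S : AddSubmonoid ℝ} (hS : ∀ x ∈ S, 0 ≤ x) (hf : HasExpansion S σ f M) (hM : M < 1) :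
    ∃ N, HasExpansion S σ (fun s => Complex.log (1 + f s)) N := by
  have hs : Summable fun k : ℕ => ‖(-1 : ℂ) ^ (k + 1) / k‖ * M ^ k := by
    refine (summable_geometric_of_lt_one hf.nonneg hM).of_nonneg_of_le
      (fun k => mul_nonneg (norm_nonneg _) (pow_nonneg hf.nonneg k)) fun k => ?_
    refine mul_le_of_le_one_left (pow_nonneg hf.nonneg k) ?_
    obtain rfl | hk := k.eq_zero_or_pos
    · simp
    · simpa using inv_le_one_of_one_le₀ (by exact_mod_cast hk)
  refine ⟨_, hasSum (F := fun (k : ℕ) s => ((-1 : ℂ) ^ (k + 1) / k) * f s ^ k) hS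
    (fun k => (hf.pow hS k).const_mul hS _) hs.hasSum fun s h => ?_⟩
  exact (hasSum_congr fun k => by ring).mp
    (Complex.hasSum_taylorSeries_log ((hf.norm_le hS h).trans_lt hM))

/-- Collecting equal frequencies. -/
theorem exists_coeff (h : HasExpansion S σ f M) :
    ∃ C : ℝ → ℂ, (∀ x ∉ S, C x = 0) ∧ (Summable fun x => ‖C x‖ * Real.exp (-(x * σ))) ∧
      ∀ s : ℂ, σ ≤ s.re → HasSum (fun x => C x * Complex.exp (-(x * s))) (f s) := by
  obtain ⟨ι, l, c, hl, hM, hf⟩ := h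
  have key : ∀ (s : ℂ) (x : ℝ), ∑' i : l ⁻¹' {x}, c i * Complex.exp (-(l i * s)) =
      (∑' i : l ⁻¹' {x}, c i) * Complex.exp (-(x * s)) := fun s x => by
    rw [← tsum_mul_right]
    exact tsum_congr fun i => by rw [show l i = x from i.2]
  refine ⟨fun x => ∑' i : l ⁻¹' {x}, c i, fun x hx => ?_, ?_, fun s hs => ?_⟩
  · have : IsEmpty (l ⁻¹' {x}) := ⟨fun i => hx (i.2 ▸ hl i)⟩
    exact tsum_empty
  · refine ((hM.tsum_fiberwise l).summable).of_nonneg_of_le (fun x => by positivity) fun x => ?_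
    have h1 := norm_mul_exp_eq (∑' i : l ⁻¹' {x}, c i) x σ
    rw [Complex.ofReal_re] at h1
    rw [← h1, ← key]
    have hn : ∀ i, ‖c i * Complex.exp (-(l i * (σ : ℂ)))‖ = ‖c i‖ * Real.exp (-(l i * σ)) :=
      fun i => by simpa using norm_mul_exp_eq (c i) (l i) σ
    simp_rw [← hn] at hM ⊢
    exact norm_tsum_le_tsum_norm (hM.summable.subtype _)
  · simpa only [key] using (hf s hs).tsum_fiberwise l

end HasExpansion

/-! ### Uniqueness of coefficients -/

/-- The mean value of `exp (i u t)` over `[0, T]` tends to zero for `u ≠ 0`. -/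
theorem tendsto_mean_cexp {u : ℝ} (hu : u ≠ 0) :
    Tendsto (fun T : ℝ => (T : ℂ)⁻¹ * ∫ t in (0 : ℝ)..T, Complex.exp (u * Complex.I * t)) atTop
      (𝓝 0) := by
  have hu' : (u * Complex.I : ℂ) ≠ 0 := by simp [hu]
  have hlim : Tendsto (fun T : ℝ => T⁻¹ * (2 / |u|)) atTop (𝓝 0) := by
    simpa using tendsto_inv_atTop_zero.mul_const (2 / |u|)
  refine squeeze_zero_norm' ?_ hlim
  filter_upwards [eventually_gt_atTop 0] with T hT
  rw [integral_exp_mul_complex hu', norm_mul, norm_div, norm_inv, Complex.norm_real,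
    Real.norm_of_nonneg hT.le]
  have h1 : ‖(u * Complex.I : ℂ)‖ = |u| := by simp
  rw [h1]
  gcongr
  refine (norm_sub_le _ _).trans ?_
  have h2 : ‖Complex.exp (u * Complex.I * T)‖ = 1 := by
    rw [show (u * Complex.I * T : ℂ) = ((u * T : ℝ) : ℂ) * Complex.I by push_cast; ring]
    exact Complex.norm_exp_ofReal_mul_I _
  rw [h2]
  norm_num

/-- Uniqueness of the coefficients of an absolutely convergent trigonometric series. -/
theorem eq_zero_of_hasSum_cexp_eq_zero {ι : Type*} [Countable ι] {l : ι → ℝ}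
    (hl : Function.Injective l) {w : ι → ℂ} (hw : Summable fun i => ‖w i‖)
    (h : ∀ t : ℝ, HasSum (fun i => w i * Complex.exp (-(l i * (t * Complex.I)))) 0) (j : ι) :
    w j = 0 := by
  classical
  have hnorm : ∀ (u t : ℝ), ‖Complex.exp (u * Complex.I * t)‖ = 1 := fun u t => by
    rw [show (u * Complex.I * t : ℂ) = ((u * t : ℝ) : ℂ) * Complex.I by push_cast; ring]
    exact Complex.norm_exp_ofReal_mul_I _
  -- Twist by `exp (i (l j) t)` so that the `j`-th term becomes constant; averaging over `[0, T]`
  -- then kills all the others in the limit.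
  have h1 : ∀ t : ℝ, HasSum (fun i => w i * Complex.exp ((l j - l i : ℝ) * Complex.I * t)) 0 := by
    intro t
    have := (h t).mul_right (Complex.exp (l j * (t * Complex.I)))
    rw [zero_mul] at this
    refine (hasSum_congr fun i => ?_).mp this
    rw [mul_assoc, ← Complex.exp_add]
    push_cast
    ring_nf
  have h2 : ∀ T : ℝ, HasSum
      (fun i => w i * ∫ t in (0 : ℝ)..T, Complex.exp ((l j - l i : ℝ) * Complex.I * t)) 0 := by
    intro T
    have := intervalIntegral.hasSum_integral_of_dominated_convergence (μ := MeasureTheory.volume)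
      (a := 0) (b := T)
      (F := fun i (t : ℝ) => w i * Complex.exp ((l j - l i : ℝ) * Complex.I * t))
      (f := fun _ => 0) (fun i _ => ‖w i‖)
      (fun i => (by fun_prop : Continuous _).aestronglyMeasurable)
      (fun i => Eventually.of_forall fun t _ => by rw [norm_mul, hnorm, mul_one])
      (Eventually.of_forall fun t _ => hw) (by simp)
      (Eventually.of_forall fun t _ => h1 t)
    simpa only [intervalIntegral.integral_const_mul, intervalIntegral.integral_zero] using this
  have h3 : Tendsto (fun T : ℝ => ∑' i, w i * ((T : ℂ)⁻¹ *
      ∫ t in (0 : ℝ)..T, Complex.exp ((l j - l i : ℝ) * Complex.I * t))) atTop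
      (𝓝 (∑' i, if i = j then w j else 0)) := by
    refine tendsto_tsum_of_dominated_convergence hw (fun i => ?_) ?_
    · split_ifs with hij
      · subst hij
        refine tendsto_const_nhds.congr' ?_
        filter_upwards [eventually_gt_atTop 0] with T hT
        have : (T : ℂ) ≠ 0 := by exact_mod_cast hT.ne'
        simp [this]
      · simpa using (tendsto_mean_cexp (u := l j - l i)
          (sub_ne_zero.mpr fun h => hij (hl h).symm)).const_mul (w i)
    · filter_upwards [eventually_gt_atTop 0] with T hT i
      rw [norm_mul, norm_mul, norm_inv, Complex.norm_real, Real.norm_of_nonneg hT.le]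
      refine mul_le_of_le_one_right (norm_nonneg _) ?_
      rw [inv_mul_le_iff₀ hT, mul_one]
      have := intervalIntegral.norm_integral_le_of_norm_le_const (a := 0) (b := T) (C := 1)
        (f := fun t : ℝ => Complex.exp ((l j - l i : ℝ) * Complex.I * t))
        fun t _ => (hnorm _ _).le
      simpa [abs_of_pos hT] using this
  rw [tsum_ite_eq] at h3
  refine tendsto_nhds_unique h3 (tendsto_const_nhds.congr fun T => ?_)
  have := ((h2 T).mul_left ((T : ℂ)⁻¹)).tsum_eq
  rw [mul_zero] at this
  rw [← this]
  exact tsum_congr fun i => by ring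

/-- The coefficients of an absolutely convergent general Dirichlet series are determined by the
values of the series on a vertical line. -/
theorem coeff_eq_of_hasSum_eq {C C' : ℝ → ℂ} {σ : ℝ} {f : ℂ → ℂ}
    (hC : Summable fun x => ‖C x‖ * Real.exp (-(x * σ)))
    (hC' : Summable fun x => ‖C' x‖ * Real.exp (-(x * σ)))
    (h : ∀ s : ℂ, σ ≤ s.re → HasSum (fun x : ℝ => C x * Complex.exp (-(x * s))) (f s))
    (h' : ∀ s : ℂ, σ ≤ s.re → HasSum (fun x : ℝ => C' x * Complex.exp (-(x * s))) (f s)) :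
    C = C' := by
  set w : ℝ → ℂ := fun x => (C x - C' x) * Complex.exp (-(x * (σ : ℂ))) with hw
  have hwn : ∀ x, ‖w x‖ = ‖C x - C' x‖ * Real.exp (-(x * σ)) := fun x => by
    have := norm_mul_exp_eq (C x - C' x) x σ
    rwa [Complex.ofReal_re] at this
  have hsum : Summable fun x => ‖w x‖ := by
    refine (hC.add hC').of_nonneg_of_le (fun x => norm_nonneg _) fun x => ?_
    rw [hwn, ← add_mul]
    gcongr
    exact norm_sub_le _ _
  have hzero : ∀ t : ℝ, HasSum (fun x : ℝ => w x * Complex.exp (-(x * (t * Complex.I)))) 0 := by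
    intro t
    have := (h (σ + t * Complex.I) (by simp)).sub (h' (σ + t * Complex.I) (by simp))
    rw [sub_self] at this
    refine (hasSum_congr fun x => ?_).mp this
    rw [hw, ← sub_mul, mul_assoc, ← Complex.exp_add]
    ring_nf
  -- Termwise integration needs a countable index set, so restrict from `ℝ` to the support.
  have hcount : Countable (Function.support w) := hsum.of_norm.countable_support.to_subtype
  ext x
  have hx : w x = 0 := by
    by_contra hx
    refine hx (eq_zero_of_hasSum_cexp_eq_zero (l := fun i : Function.support w => (i : ℝ))
      Subtype.val_injective (w := fun i => w i) (hsum.subtype _) (fun t => ?_) ⟨x, hx⟩)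
    refine (hasSum_subtype_iff_of_support_subset (f := fun x : ℝ =>
      w x * Complex.exp (-(x * (t * Complex.I)))) ?_).mpr (hzero t)
    exact Function.support_mul_subset_left _ _
  simpa [hw, sub_eq_zero] using hx

/-- A gap `δ` above frequency zero makes the norm decay like `exp (-(δ * τ))`. This supplies the
smallness needed for the logarithm and for the margin above `1/2`. -/
theorem HasExpansion.exists_lt {S : Set ℝ} {σ δ M : ℝ} {f : ℂ → ℂ} (h : HasExpansion S σ f M)
    (hδ : 0 < δ) (hS : ∀ x ∈ S, δ ≤ x) {ε : ℝ} (hε : 0 < ε) :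
    ∃ σ₀, ∀ τ ≥ σ₀, ∃ N < ε, HasExpansion S τ f N := by
  have hlim : Tendsto (fun τ : ℝ => Real.exp (-(δ * (τ - σ))) * M) atTop (𝓝 (0 * M)) := by
    refine Tendsto.mul_const M (Real.tendsto_exp_neg_atTop_nhds_zero.comp ?_)
    exact (tendsto_atTop_add_const_right _ (-σ) tendsto_id).const_mul_atTop hδ
  rw [zero_mul] at hlim
  obtain ⟨σ₀, hσ₀⟩ := eventually_atTop.mp
    ((hlim.eventually_lt_const hε).and (eventually_ge_atTop σ))
  refine ⟨σ₀, fun τ hτ => ?_⟩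
  obtain ⟨N, hN, hf⟩ := h.exists_mono hS (hσ₀ τ hτ).2
  exact ⟨N, hN.trans_lt (hσ₀ τ hτ).1, hf⟩

/-! ### Frequency sets, and passage to and from ordinary Dirichlet series -/

/-- The logarithms of the numbers `n / p ^ j ≥ 1`. -/
def freq (p : ℕ) : AddSubmonoid ℝ where
  carrier := {x | 0 ≤ x ∧ ∃ n j : ℕ, 0 < n ∧ x = Real.log n - j * Real.log p}
  zero_mem' := ⟨le_rfl, 1, 0, one_pos, by simp⟩
  add_mem' := by
    rintro _ _ ⟨hx, n, j, hn, rfl⟩ ⟨hy, n', j', hn', rfl⟩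
    refine ⟨add_nonneg hx hy, n * n', j + j', Nat.mul_pos hn hn', ?_⟩
    have h1 : (n : ℝ) ≠ 0 := by positivity
    have h2 : (n' : ℝ) ≠ 0 := by positivity
    push_cast
    rw [Real.log_mul h1 h2]
    ring

theorem freq_nonneg {p : ℕ} : ∀ x ∈ freq p, 0 ≤ x := fun _ hx => hx.1

theorem exists_log_nat_of_mem_freq_one {x : ℝ} (hx : x ∈ freq 1) :
    ∃ n : ℕ, 0 < n ∧ x = Real.log n := by
  obtain ⟨-, n, j, hn, rfl⟩ := hx
  exact ⟨n, hn, by simp⟩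

/-- Equating `n / p ^ j` with `n' / q ^ j'` gives `n * q ^ j' = n' * p ^ j`, and coprimality yields
`p ^ j ∣ n`. -/
theorem exists_log_nat_of_mem_freq_of_coprime {p q : ℕ} (hp : 0 < p) (hq : 0 < q)
    (hpq : p.Coprime q) {x : ℝ} (hxp : x ∈ freq p) (hxq : x ∈ freq q) :
    ∃ n : ℕ, 0 < n ∧ x = Real.log n := by
  obtain ⟨-, n, j, hn, rfl⟩ := hxp
  obtain ⟨-, n', j', hn', h⟩ := hxq
  have h1 : (n : ℝ) ≠ 0 := by positivity
  have h2 : (n' : ℝ) ≠ 0 := by positivity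
  have hp' : (p : ℝ) ^ j ≠ 0 := by positivity
  have hq' : (q : ℝ) ^ j' ≠ 0 := by positivity
  have heq : n * q ^ j' = n' * p ^ j := by
    have h3 : Real.log (n * (q : ℝ) ^ j') = Real.log (n' * (p : ℝ) ^ j) := by
      rw [Real.log_mul h1 hq', Real.log_mul h2 hp', Real.log_pow, Real.log_pow]
      linarith
    have := Real.log_injOn_pos (Set.mem_Ioi.mpr (by positivity)) (Set.mem_Ioi.mpr (by positivity)) h3
    exact_mod_cast this
  have hdvd : p ^ j ∣ n :=
    (Nat.Coprime.pow j j' hpq).dvd_of_dvd_mul_right (heq ▸ Dvd.intro_left n' rfl)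
  obtain ⟨k, rfl⟩ := hdvd
  have hk : 0 < k := Nat.pos_of_mul_pos_left hn
  refine ⟨k, hk, ?_⟩
  push_cast
  rw [Real.log_mul hp' (by positivity), Real.log_pow]
  ring

theorem natCast_cpow_eq_exp {n : ℕ} (hn : 0 < n) (s : ℂ) :
    (n : ℂ) ^ s = Complex.exp (Real.log n * s) := by
  rw [Complex.cpow_def_of_ne_zero (by exact_mod_cast hn.ne'), Complex.natCast_log]

/-- After division by its leading frequency, an absolutely convergent Dirichlet series is its
leading coefficient plus an expansion in strictly positive frequencies. -/
theorem exists_hasExpansion_of_lSeriesSummable {a : ℕ → ℂ} {m : ℕ} (hm : 0 < m)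
    (ha : ∀ k < m, a k = 0) {σ : ℝ} (hσ : LSeriesSummable a σ) :
    ∃ M, HasExpansion (freq m ∩ Set.Ici (Real.log (m + 1) - Real.log m)) σ
      (fun s => (m : ℂ) ^ s * LSeries a s - a m) M := by
  have hm' : (0 : ℝ) < m := by exact_mod_cast hm
  have hterm : ∀ (s : ℂ) (k : ℕ), (m : ℂ) ^ s * LSeries.term a s (k + (m + 1)) =
      a (k + (m + 1)) *
        Complex.exp (-((Real.log ((k + (m + 1) : ℕ) : ℝ) - Real.log m : ℝ) * s)) := by
    intro s k
    rw [LSeries.term_of_ne_zero (by omega), natCast_cpow_eq_exp hm, natCast_cpow_eq_exp (by omega),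
      div_eq_mul_inv, ← Complex.exp_neg, mul_left_comm, ← Complex.exp_add]
    push_cast
    ring_nf
  refine ⟨∑' k : ℕ, ‖a (k + (m + 1))‖ *
    Real.exp (-((Real.log ((k + (m + 1) : ℕ) : ℝ) - Real.log m) * σ)), ℕ,
    fun k => Real.log ((k + (m + 1) : ℕ) : ℝ) - Real.log m, fun k => a (k + (m + 1)),
    fun k => ?_, ?_, fun s hs => ?_⟩
  · have h1 : Real.log (m + 1) ≤ Real.log ((k + (m + 1) : ℕ) : ℝ) := by
      refine Real.log_le_log (by positivity) ?_
      push_cast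
      linarith [k.cast_nonneg (α := ℝ)]
    have h2 : Real.log m ≤ Real.log (m + 1) := Real.log_le_log hm' (by linarith)
    exact ⟨⟨by linarith, k + (m + 1), 1, Nat.succ_pos _, by simp⟩, by simp only [Set.mem_Ici]; linarith⟩
  · refine Summable.hasSum ?_
    refine (((summable_nat_add_iff (m + 1)).mpr hσ).mul_left ((m : ℂ) ^ (σ : ℂ))).norm.congr
      fun k => ?_
    rw [hterm, norm_mul_exp_eq, Complex.ofReal_re]
  · have hsum : HasSum (fun k => (m : ℂ) ^ s * LSeries.term a s k) ((m : ℂ) ^ s * LSeries a s) :=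
      (hσ.of_re_le_re (by simpa using hs)).hasSum.mul_left _
    have := (hasSum_nat_add_iff' (m + 1)).mpr hsum
    have h0 : ∑ k ∈ Finset.range (m + 1), (m : ℂ) ^ s * LSeries.term a s k = a m := by
      rw [Finset.sum_range_succ, Finset.sum_eq_zero, zero_add, LSeries.term_of_ne_zero hm.ne',
        mul_div_cancel₀]
      · rw [natCast_cpow_eq_exp hm]
        exact Complex.exp_ne_zero _
      · intro k hk
        rcases Nat.eq_zero_or_pos k with rfl | hk0
        · simp
        · rw [LSeries.term_of_ne_zero hk0.ne', ha k (Finset.mem_range.mp hk)]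
          simp
    rw [h0] at this
    exact (hasSum_congr fun k => hterm s k).mp this

/-- A function with expansions in two frequency sets meeting only in logarithms of natural numbers
is the sum of an ordinary Dirichlet series. -/
theorem exists_lSeries_eq_of_hasExpansion {S T : Set ℝ} {σ M N : ℝ} {f : ℂ → ℂ}
    (hS : HasExpansion S σ f M) (hT : HasExpansion T σ f N)
    (hST : ∀ x ∈ S, x ∈ T → ∃ n : ℕ, 0 < n ∧ x = Real.log n) :
    ∃ e : ℕ → ℂ, e 0 = 0 ∧ ∀ s : ℂ, σ ≤ s.re → LSeriesSummable e s ∧ LSeries e s = f s := by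
  obtain ⟨C, hC0, hCs, hC⟩ := hS.exists_coeff
  obtain ⟨C', hC0', hCs', hC'⟩ := hT.exists_coeff
  obtain rfl := coeff_eq_of_hasSum_eq hCs hCs' hC hC'
  -- The shift by one is needed because `Real.log 0 = Real.log 1`.
  have hinj : Function.Injective fun n : ℕ => Real.log ((n + 1 : ℕ) : ℝ) := fun n k h => by
    have := Real.log_injOn_pos (Set.mem_Ioi.mpr (by positivity)) (Set.mem_Ioi.mpr (by positivity)) h
    have : n + 1 = k + 1 := by exact_mod_cast this
    omega
  refine ⟨fun n => if n = 0 then 0 else C (Real.log n), rfl, fun s hs => ?_⟩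
  have h1 := (hinj.hasSum_iff (f := fun x : ℝ => C x * Complex.exp (-(x * s))) (a := f s) ?_).mpr
    (hC s hs)
  · have h2 : HasSum (LSeries.term (fun n => if n = 0 then 0 else C (Real.log n)) s) (f s) := by
      refine (hasSum_nat_add_iff' 1).mp ?_
      rw [Finset.sum_range_one, LSeries.term_zero, sub_zero]
      refine (hasSum_congr fun n => ?_).mp h1
      rw [LSeries.term_of_ne_zero (Nat.succ_ne_zero n), if_neg (Nat.succ_ne_zero n),
        natCast_cpow_eq_exp (Nat.succ_pos n), div_eq_mul_inv, ← Complex.exp_neg]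
      rfl
    exact ⟨h2.summable, h2.tsum_eq⟩
  · intro x hx
    have : C x = 0 := by
      by_contra hne
      obtain ⟨n, hn, rfl⟩ := hST x (by_contra fun h => hne (hC0 x h))
        (by_contra fun h => hne (hC0' x h))
      exact hx ⟨n - 1, by simp only [Nat.sub_add_cancel hn]⟩
    simp [this]

theorem lSeries_eq_of_hasSumAt {a : ℕ → ℂ} {σ : ℝ} {g : ℂ → ℂ}
    (h : ∀ s ∈ halfPlane σ, HasSumAt a s (g s)) {s : ℂ} (hs : σ + 1 < s.re) :
    LSeriesSummable a s ∧ LSeries a s = g s := by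
  have h1 : LSeriesSummable a s := by
    -- The midpoint of `σ` and `s.re - 1` lies in the half-plane of convergence and more than one
    -- unit to the left of `s`.
    refine (h (((s.re - 1 + σ) / 2 : ℝ) : ℂ) ?_).summable ?_
    · simp only [halfPlane, Set.mem_ofPred_eq, Complex.ofReal_re]; linarith
    · rw [Complex.ofReal_re]; linarith
  exact ⟨h1, tendsto_nhds_unique (hasSumAt_of_summable h1)
    (h s (by simp only [halfPlane, Set.mem_ofPred_eq]; linarith))⟩

theorem mem_D_of_lSeriesSummable {a : ℕ → ℂ} (h0 : a 0 = 0) {s : ℂ} (h : LSeriesSummable a s) :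
    a ∈ D :=
  ⟨h0, s, _, hasSumAt_of_summable h⟩

/-! ### Necessity: the form of the symbol -/

theorem single_mem_HPlus {n : ℕ} (hn : 0 < n) : (Pi.single n 1 : ℕ → ℂ) ∈ HPlus := by
  refine ⟨Pi.single_eq_of_ne hn.ne _, fun k _ => ⟨?_, ?_⟩⟩
  · simp [translate, Pi.single_eq_of_ne hn.ne]
  · refine memℓp_gen (summable_of_ne_finset_zero (s := {n}) fun i hi => ?_)
    rw [Finset.notMem_singleton] at hi
    simp [translate, Pi.single_eq_of_ne hi]

theorem eq_of_hasSumAt_single {n : ℕ} (hn : 0 < n) {s v : ℂ}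
    (h : HasSumAt (Pi.single n 1 : ℕ → ℂ) s v) : v = (n : ℂ) ^ (-s) := by
  refine tendsto_nhds_unique h (tendsto_const_nhds.congr' ?_)
  filter_upwards [eventually_ge_atTop n] with N hN
  rw [Finset.sum_eq_single n (fun k _ hk => by simp [Pi.single_eq_of_ne hk])
    (fun h => absurd (Finset.mem_Icc.mpr ⟨hn, hN⟩) h)]
  simp

/-- The Dirichlet series of `n ^ (-φ)` together with its leading index `m`. -/
structure IsPowerSeriesOf (φ : ℂ → ℂ) (n : ℕ) (d : ℕ → ℂ) (m : ℕ) (σ : ℝ) : Prop where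
  pos : 0 < m
  eq_zero : ∀ k < m, d k = 0
  ne_zero : d m ≠ 0
  lSeries : ∀ s : ℂ, σ ≤ s.re → LSeriesSummable d s ∧ LSeries d s = (n : ℂ) ^ (-φ s)

theorem DefinesCompositionOperator.exists_isPowerSeriesOf {θ : ℝ} {φ : ℂ → ℂ}
    (h : DefinesCompositionOperator θ φ) {n : ℕ} (hn : 0 < n) :
    ∃ d m σ, IsPowerSeriesOf φ n d m σ := by
  classical
  obtain ⟨C, hC⟩ := h
  obtain ⟨σ, -, hσ⟩ := hC ⟨_, single_mem_HPlus hn⟩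
  set d : ℕ → ℂ := (C ⟨_, single_mem_HPlus hn⟩).1
  have hd0 : d 0 = 0 := (C ⟨_, single_mem_HPlus hn⟩).2.1
  have hd : ∀ s ∈ halfPlane σ, HasSumAt d s ((n : ℂ) ^ (-φ s)) := fun s hs => by
    obtain ⟨v, hv, hv'⟩ := hσ s hs
    rwa [← eq_of_hasSumAt_single hn hv]
  have hL : ∀ s : ℂ, σ + 2 ≤ s.re → LSeriesSummable d s ∧ LSeries d s = (n : ℂ) ^ (-φ s) :=
    fun s hs => lSeries_eq_of_hasSumAt hd (by linarith)
  -- A leading index exists because `n ^ (-φ s)` is an exponential and never vanishes.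
  have hex : ∃ k, d k ≠ 0 := by
    by_contra! hall
    have h1 := (hL ((σ + 2 : ℝ) : ℂ) (by simp)).2
    rw [show d = 0 from funext hall, LSeries_zero, natCast_cpow_eq_exp hn] at h1
    exact Complex.exp_ne_zero _ h1.symm
  refine ⟨d, Nat.find hex, σ + 2, ?_, fun k hk => by_contra (Nat.find_min hex hk),
    Nat.find_spec hex, hL⟩
  exact Nat.pos_of_ne_zero fun h0 => Nat.find_spec hex (h0 ▸ hd0)

theorem IsPowerSeriesOf.abscissa_lt_top {φ : ℂ → ℂ} {n : ℕ} {d : ℕ → ℂ} {m : ℕ} {σ : ℝ}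
    (h : IsPowerSeriesOf φ n d m σ) : LSeries.abscissaOfAbsConv d < ⊤ :=
  (h.lSeries σ (by simp)).1.abscissaOfAbsConv_le.trans_lt (EReal.coe_lt_top _)

theorem tendsto_cpow_mul_lSeries {a : ℕ → ℂ} {m : ℕ} (hm : 0 < m) (ha : ∀ k < m, a k = 0)
    (h : LSeries.abscissaOfAbsConv a < ⊤) :
    Tendsto (fun x : ℝ => (m : ℂ) ^ (x : ℂ) * LSeries a x) atTop (𝓝 (a m)) := by
  obtain ⟨k, rfl⟩ := Nat.exists_eq_add_of_lt hm
  simp only [zero_add] at ha ⊢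
  simpa using LSeries.tendsto_cpow_mul_atTop (fun i hi => ha i (by omega)) h

/-- This is the logarithm of the modulus in `m ^ x * n ^ (-φ x) → d m ≠ 0`. -/
theorem IsPowerSeriesOf.tendsto {φ : ℂ → ℂ} {n : ℕ} {d : ℕ → ℂ} {m : ℕ} {σ : ℝ}
    (h : IsPowerSeriesOf φ n d m σ) (hn : 0 < n) :
    Tendsto (fun x : ℝ => x * Real.log m - (φ x).re * Real.log n) atTop
      (𝓝 (Real.log ‖d m‖)) := by
  have h1 := ((tendsto_cpow_mul_lSeries h.pos h.eq_zero h.abscissa_lt_top).norm).log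
    (norm_ne_zero_iff.mpr h.ne_zero)
  refine h1.congr' ?_
  filter_upwards [eventually_ge_atTop σ] with x hx
  rw [(h.lSeries x (by simpa using hx)).2, natCast_cpow_eq_exp h.pos, natCast_cpow_eq_exp hn,
    ← Complex.exp_add, Complex.norm_exp, Real.log_exp]
  simp only [Complex.add_re, Complex.mul_re, Complex.ofReal_re, Complex.ofReal_im, Complex.neg_re]
  ring

/-- Eliminating `Re φ x` between the two asymptotics leaves a multiple of `x` with a finite limit,
so its coefficient is zero. -/
theorem IsPowerSeriesOf.log_mul_log_eq {φ : ℂ → ℂ} {n n' : ℕ} {d d' : ℕ → ℂ} {m m' : ℕ} {σ σ' : ℝ}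
    (h : IsPowerSeriesOf φ n d m σ) (hn : 0 < n) (h' : IsPowerSeriesOf φ n' d' m' σ')
    (hn' : 0 < n') : Real.log n' * Real.log m = Real.log n * Real.log m' := by
  refine sub_eq_zero.mp (eq_zero_of_tendsto_mul_id ((((h.tendsto hn).const_mul (Real.log n')).sub
    ((h'.tendsto hn').const_mul (Real.log n))).congr fun x => ?_))
  ring

theorem DefinesCompositionOperator.exists_characteristic {θ : ℝ} {φ : ℂ → ℂ}
    (h : DefinesCompositionOperator θ φ) :
    ∃ c : ℕ, ∀ n > 0, ∃ d σ, IsPowerSeriesOf φ n d (n ^ c) σ := by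
  obtain ⟨d₂, m₂, σ₂, h₂⟩ := h.exists_isPowerSeriesOf two_pos
  have hlog2 : 0 < Real.log (2 : ℕ) := Real.log_pos (by norm_num)
  have key : ∀ n > 0, ∃ d σ, ∃ m : ℕ, IsPowerSeriesOf φ n d m σ ∧
      (n : ℝ) ^ (Real.log m₂ / Real.log (2 : ℕ)) = m := fun n hn => by
    obtain ⟨d, m, σ, hd⟩ := h.exists_isPowerSeriesOf hn
    refine ⟨d, σ, m, hd, ?_⟩
    have := hd.log_mul_log_eq hn h₂ two_pos
    have hm : (0 : ℝ) < m := by exact_mod_cast hd.pos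
    rw [Real.rpow_def_of_pos (by exact_mod_cast hn), ← mul_div_assoc, ← this,
      mul_div_cancel_left₀ _ hlog2.ne', Real.exp_log hm]
  obtain ⟨c, hc⟩ := exists_nat_eq_of_rpow_mem_nat fun n hn =>
    let ⟨_, _, m, _, hm⟩ := key n hn; ⟨m, hm⟩
  refine ⟨c, fun n hn => ?_⟩
  obtain ⟨d, σ, m, hd, hm⟩ := key n hn
  rw [hc, Real.rpow_natCast] at hm
  have : n ^ c = m := by exact_mod_cast hm
  exact ⟨d, σ, this ▸ hd⟩

/-- Up to integer multiples of `2πi / log n`, the function `φ - c s` has an expansion in the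
frequencies `log (k / n ^ (c j))`. -/
theorem IsPowerSeriesOf.exists_hasExpansion {φ : ℂ → ℂ} {n c : ℕ} {d : ℕ → ℂ} {σ : ℝ}
    (h : IsPowerSeriesOf φ n d (n ^ c) σ) (hn : 1 < n) :
    ∃ τ₀, ∀ τ ≥ τ₀, ∃ g N, HasExpansion (freq (n ^ c)) τ g N ∧ ∀ s : ℂ, τ ≤ s.re →
      ∃ k : ℤ, φ s - c * s = g s + k * (2 * Real.pi * Complex.I / Real.log n) := by
  have hn0 : 0 < n := by omega
  have hlogn : (Real.log n : ℂ) ≠ 0 := by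
    exact_mod_cast (Real.log_pos (by exact_mod_cast hn)).ne'
  set m := n ^ c with hm
  obtain ⟨M, hM⟩ := exists_hasExpansion_of_lSeriesSummable h.pos h.eq_zero
    (h.lSeries σ (by simp)).1
  have hm' : (0 : ℝ) < m := by exact_mod_cast h.pos
  -- Far enough right the tail is smaller than the leading coefficient, so the power series of `log
  -- (1 + z)` applies.
  obtain ⟨τ₀, hτ₀⟩ := hM.exists_lt
    (sub_pos.mpr (Real.log_lt_log hm' (lt_add_one (m : ℝ)))) (fun x hx => hx.2)
    (norm_pos_iff.mpr h.ne_zero)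
  refine ⟨max τ₀ σ, fun τ hτ => ?_⟩
  obtain ⟨N, hN, hE⟩ := hτ₀ τ ((le_max_left _ _).trans hτ)
  have hE' := (hE.mono_freq Set.inter_subset_left).const_mul freq_nonneg (d m)⁻¹
  have hN' : ‖(d m)⁻¹‖ * N < 1 := by
    rw [norm_inv, inv_mul_lt_iff₀ (norm_pos_iff.mpr h.ne_zero), mul_one]
    exact hN
  obtain ⟨K, hK⟩ := hE'.clog freq_nonneg hN'
  refine ⟨_, _, (((HasExpansion.const (freq m).zero_mem (Complex.log (d m))).add freq_nonneg
    hK).const_mul freq_nonneg (-(Real.log n : ℂ)⁻¹)), fun s hs => ?_⟩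
  have hlt := (hE'.norm_le freq_nonneg hs).trans_lt hN'
  have hne : 1 + (d m)⁻¹ * ((m : ℂ) ^ s * LSeries d s - d m) ≠ 0 := fun h0 => by
    rw [eq_neg_of_add_eq_zero_right h0] at hlt
    simp at hlt
  have hexp : Complex.exp (Complex.log (d m) +
      Complex.log (1 + (d m)⁻¹ * ((m : ℂ) ^ s * LSeries d s - d m))) =
      Complex.exp (-(Real.log n * (φ s - c * s))) := by
    rw [Complex.exp_add, Complex.exp_log h.ne_zero, Complex.exp_log hne,
      (h.lSeries s ((le_max_right _ _).trans (hτ.trans hs))).2, mul_add,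
      mul_inv_cancel_left₀ h.ne_zero, natCast_cpow_eq_exp h.pos, natCast_cpow_eq_exp hn0, hm,
      Nat.cast_pow, Real.log_pow, mul_one, add_sub_cancel, ← Complex.exp_add]
    congr 1
    push_cast
    ring
  obtain ⟨k, hk⟩ := Complex.exp_eq_exp_iff_exists_int.mp hexp
  refine ⟨k, ?_⟩
  rw [hk]
  field_simp
  ring

/-- The relation exponentiates to an equality of a power of 3 and a power of 2, excluded by parity
unless both are 1. -/
theorem eq_zero_of_mul_log_three_eq_mul_log_two {k l : ℤ}
    (h : k * Real.log 3 = l * Real.log 2) : k = 0 ∧ l = 0 := by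
  have h1 : 3 ^ k.natAbs = 2 ^ l.natAbs := by
    have h2 := congrArg abs h
    rw [abs_mul, abs_mul, abs_of_pos (Real.log_pos (by norm_num : (1 : ℝ) < 3)),
      abs_of_pos (Real.log_pos (by norm_num : (1 : ℝ) < 2)), ← Int.cast_abs, ← Int.cast_abs,
      ← Int.natCast_natAbs, ← Int.natCast_natAbs, Int.cast_natCast, Int.cast_natCast,
      ← Real.log_pow, ← Real.log_pow] at h2
    have := Real.log_injOn_pos (Set.mem_Ioi.mpr (by positivity)) (Set.mem_Ioi.mpr (by positivity)) h2
    exact_mod_cast this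
  have hl : l.natAbs = 0 := by
    by_contra hl
    have h3 : Odd (3 ^ k.natAbs) := Odd.pow (by decide)
    rw [h1] at h3
    exact Nat.not_even_iff_odd.mpr h3 ((Nat.even_pow.mpr ⟨even_two, hl⟩))
  rw [hl, pow_zero] at h1
  have hk : k.natAbs = 0 := by
    by_contra hk
    exact (Nat.one_lt_pow hk (by norm_num : 1 < 3)).ne' h1
  exact ⟨Int.natAbs_eq_zero.mp hk, Int.natAbs_eq_zero.mp hl⟩

theorem isPreconnected_re_ge (τ : ℝ) : IsPreconnected {s : ℂ | τ ≤ s.re} :=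
  (convex_halfSpace_re_ge τ).isPreconnected

theorem DefinesCompositionOperator.exists_eq {θ : ℝ} {φ : ℂ → ℂ}
    (h : DefinesCompositionOperator θ φ) :
    ∃ μ : ℝ, θ ≤ μ ∧ AnalyticOnNhd ℂ φ (halfPlane μ) ∧
      ∃ c₀ : ℕ, ∃ ϕ ∈ D, ∀ s ∈ halfPlane μ, ∃ v : ℂ, HasSumAt ϕ s v ∧ φ s = c₀ * s + v := by
  obtain ⟨c, hc⟩ := h.exists_characteristic
  obtain ⟨d₂, σ₂, h₂⟩ := hc 2 two_pos
  obtain ⟨d₃, σ₃, h₃⟩ := hc 3 three_pos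
  obtain ⟨τ₂, hτ₂⟩ := h₂.exists_hasExpansion one_lt_two
  obtain ⟨τ₃, hτ₃⟩ := h₃.exists_hasExpansion (by norm_num)
  set τ := max θ (max τ₂ τ₃)
  obtain ⟨g₂, N₂, hg₂, hφ₂⟩ := hτ₂ τ ((le_max_left _ _).trans (le_max_right _ _))
  obtain ⟨g₃, N₃, hg₃, hφ₃⟩ := hτ₃ τ ((le_max_right _ _).trans (le_max_right _ _))
  have hlog2 : (Real.log (2 : ℕ) : ℂ) ≠ 0 := by
    exact_mod_cast (Real.log_pos (by norm_num)).ne'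
  have hlog3 : (Real.log (3 : ℕ) : ℂ) ≠ 0 := by
    exact_mod_cast (Real.log_pos (by norm_num)).ne'
  have hindep : ∀ k l : ℤ, (k : ℂ) * (2 * Real.pi * Complex.I / Real.log (2 : ℕ)) =
      l * (2 * Real.pi * Complex.I / Real.log (3 : ℕ)) → k = 0 ∧ l = 0 := by
    intro k l hkl
    have hpi : (Real.pi : ℂ) ≠ 0 := by exact_mod_cast Real.pi_ne_zero
    refine eq_zero_of_mul_log_three_eq_mul_log_two ?_
    field_simp at hkl
    norm_cast at hkl ⊢
    rw [hkl, mul_comm]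
  -- The comparison is made in both directions: each expansion of `φ - c s` needs its own constant,
  -- which is absorbed at frequency zero.
  obtain ⟨k₂, hk₂⟩ := exists_eq_add_zsmul_of_isPreconnected (isPreconnected_re_ge τ)
    (hg₂.continuousOn freq_nonneg) (hg₃.continuousOn freq_nonneg)
    (fun k l hkl => (hindep k l hkl).1) hφ₂ hφ₃
  obtain ⟨k₃, hk₃⟩ := exists_eq_add_zsmul_of_isPreconnected (isPreconnected_re_ge τ)
    (hg₃.continuousOn freq_nonneg) (hg₂.continuousOn freq_nonneg)
    (fun k l hkl => (hindep l k hkl.symm).2) hφ₃ hφ₂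
  obtain ⟨e, he0, he⟩ := exists_lSeries_eq_of_hasExpansion (f := fun s => φ s - c * s)
    ((hg₂.add freq_nonneg (HasExpansion.const (freq _).zero_mem _)).congr hk₂)
    ((hg₃.add freq_nonneg (HasExpansion.const (freq _).zero_mem _)).congr hk₃)
    (fun x hx hx' => exists_log_nat_of_mem_freq_of_coprime (by positivity) (by positivity)
      (Nat.Coprime.pow c c (by norm_num)) hx hx')
  have habs : LSeries.abscissaOfAbsConv e ≤ τ :=
    (he τ (by simp)).1.abscissaOfAbsConv_le
  have heq : ∀ s ∈ halfPlane τ, φ s = c * s + LSeries e s := fun s hs => by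
    rw [(he s (le_of_lt hs)).2]
    ring
  refine ⟨τ, le_max_left _ _, ?_, c, e, mem_D_of_lSeriesSummable he0 (he τ (by simp)).1,
    fun s hs => ⟨LSeries e s, hasSumAt_of_summable (he s (le_of_lt hs)).1, heq s hs⟩⟩
  have hopen : IsOpen (halfPlane τ) := isOpen_lt continuous_const Complex.continuous_re
  refine AnalyticOnNhd.congr hopen (f := fun s => c * s + LSeries e s) ?_ fun s hs => (heq s hs).symm
  refine (analyticOnNhd_const.mul analyticOnNhd_id).add ((LSeries_analyticOnNhd e).mono ?_)
  intro s hs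
  exact habs.trans_lt (EReal.coe_lt_coe_iff.mpr hs)

/-! ### Sufficiency: construction of the operator -/

theorem term_mul_cpow (b : ℕ → ℂ) (w s : ℂ) (k : ℕ) :
    LSeries.term (fun k => b k * (k : ℂ) ^ (-w)) s k = LSeries.term b (s + w) k := by
  obtain rfl | hk := Nat.eq_zero_or_pos k
  · simp
  · rw [LSeries.term_of_ne_zero hk.ne', LSeries.term_of_ne_zero hk.ne',
      Complex.cpow_add _ _ (by exact_mod_cast hk.ne'), Complex.cpow_neg]
    field_simp

theorem lSeries_mul_cpow (b : ℕ → ℂ) (w s : ℂ) :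
    LSeries (fun k => b k * (k : ℂ) ^ (-w)) s = LSeries b (s + w) :=
  tsum_congr (term_mul_cpow b w s)

/-- A Dirichlet series without constant term whose real part is nonnegative on a half-plane
vanishes. -/
theorem eq_zero_of_lSeries_re_nonneg {b : ℕ → ℂ} (h0 : b 0 = 0) (h1 : b 1 = 0) {σ : ℝ}
    (h : ∀ s : ℂ, σ ≤ s.re → LSeriesSummable b s ∧ 0 ≤ (LSeries b s).re) : b = 0 := by
  classical
  by_contra hb
  have hex : ∃ k, b k ≠ 0 := Function.ne_iff.mp hb
  set m := Nat.find hex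
  have hbm : b m ≠ 0 := Nat.find_spec hex
  have hmin : ∀ k < m, b k = 0 := fun k hk => by_contra (Nat.find_min hex hk)
  have hm : 1 < m := by
    by_contra hm
    interval_cases m <;> contradiction
  have hm0 : 0 < m := by omega
  have hlog : Real.log m ≠ 0 := (Real.log_pos (by exact_mod_cast hm)).ne'
  -- The height at which the leading term `b m * m ^ (-s)` is negative real; it dominates the series
  -- along that horizontal ray.
  set t : ℝ := ((b m).arg - Real.pi) / Real.log m with ht
  have hrot : b m * (m : ℂ) ^ (-(t * Complex.I)) = -‖b m‖ := by
    have h2 : (Real.log m : ℂ) * -(t * Complex.I) =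
        -((b m).arg * Complex.I) + Real.pi * Complex.I := by
      have : (Real.log m : ℂ) * t = (b m).arg - Real.pi := by
        rw [ht]
        push_cast
        rw [mul_div_cancel₀]
        exact_mod_cast hlog
      linear_combination (-Complex.I) * this
    rw [natCast_cpow_eq_exp hm0, h2, Complex.exp_add, Complex.exp_pi_mul_I]
    nth_rewrite 1 [← Complex.norm_mul_exp_arg_mul_I (b m)]
    rw [Complex.exp_neg]
    field_simp [Complex.exp_ne_zero]
  set b' : ℕ → ℂ := fun k => b k * (k : ℂ) ^ (-(t * Complex.I))
  have hb' : LSeriesSummable b' σ :=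
    Summable.congr (h (σ + t * Complex.I) (by simp)).1 fun k => (term_mul_cpow b _ _ k).symm
  have hlim := tendsto_cpow_mul_lSeries (a := b') hm0 (fun k hk => by simp [b', hmin k hk])
    (hb'.abscissaOfAbsConv_le.trans_lt (EReal.coe_lt_top _))
  have hlim' := (Complex.continuous_re.tendsto _).comp hlim
  have hnonneg : 0 ≤ (b' m).re := by
    refine ge_of_tendsto hlim' ?_
    filter_upwards [eventually_ge_atTop σ] with x hx
    rw [Function.comp_apply, lSeries_mul_cpow, natCast_cpow_eq_exp hm0, ← Complex.ofReal_mul,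
      ← Complex.ofReal_exp, Complex.re_ofReal_mul]
    exact mul_nonneg (Real.exp_nonneg _) (h _ (by simpa using hx)).2
  have : 0 < ‖b m‖ := norm_pos_iff.mpr hbm
  simp only [b', hrot, Complex.neg_re, Complex.ofReal_re] at hnonneg
  linarith

/-- Otherwise removing the constant term leaves a series with nonnegative real part, hence zero. The
sum is then the constant `a 1`, against the strict bound on its real part. -/
theorem lt_re_coeff_one {a : ℕ → ℂ} (h0 : a 0 = 0) {σ r : ℝ}
    (h : ∀ s : ℂ, σ ≤ s.re → LSeriesSummable a s ∧ r < (LSeries a s).re) : r < (a 1).re := by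
  by_contra! hr
  set b : ℕ → ℂ := a - a 1 • LSeries.delta with hb
  have hdelta : ∀ s, LSeriesSummable LSeries.delta s := fun s =>
    summable_of_ne_finset_zero (s := {1}) fun n hn => by
      rw [Finset.notMem_singleton] at hn
      obtain rfl | hn0 := Nat.eq_zero_or_pos n
      · simp
      · rw [LSeries.term_of_ne_zero hn0.ne']
        simp [LSeries.delta, hn]
  have hL : ∀ s : ℂ, σ ≤ s.re → LSeriesSummable b s ∧ LSeries b s = LSeries a s - a 1 :=
    fun s hs => by
      refine ⟨(h s hs).1.sub ((hdelta s).smul _), ?_⟩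
      rw [hb, LSeries_sub (h s hs).1 ((hdelta s).smul _), LSeries_smul, LSeries_delta]
      simp
  have hb0 : b = 0 := eq_zero_of_lSeries_re_nonneg (σ := σ) (by simp [hb, h0, LSeries.delta])
    (by simp [hb, LSeries.delta]) fun s hs => by
      refine ⟨(hL s hs).1, ?_⟩
      rw [(hL s hs).2, Complex.sub_re]
      linarith [(h s hs).2]
  have h1 := hL σ (by simp)
  have h2 := (h σ (by simp)).2
  rw [hb0, LSeries_zero, Pi.zero_apply] at h1
  rw [← sub_eq_zero.mp h1.2.symm] at hr
  linarith

theorem lSeriesSummable_of_mem_HPlus {a : ℕ → ℂ} (ha : a ∈ HPlus) {s : ℂ} (hs : 1 / 2 < s.re) :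
    LSeriesSummable a s := by
  refine Summable.of_norm_bounded (summable_norm_mul_rpow_of_mem_HPlus ha hs) fun n => ?_
  rw [LSeries.norm_term_eq]
  split_ifs with hn
  · positivity
  · rw [Real.rpow_neg (by positivity), div_eq_mul_inv]

/-- The expansion of `n ^ (-φ)` for `φ s = c s + c₁ + E s`. -/
theorem HasExpansion.natCast_cpow {E φ : ℂ → ℂ} {τ N : ℝ} {c : ℕ} {c₁ : ℂ}
    (hE : HasExpansion (freq 1) τ E N) (hφ : ∀ s : ℂ, τ ≤ s.re → φ s = c * s + c₁ + E s)
    {n : ℕ} (hn : 0 < n) :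
    HasExpansion (freq 1) τ (fun s => (n : ℂ) ^ (-φ s))
      ((n : ℝ) ^ (-(c₁.re + c * τ - N))) := by
  have hn' : (0 : ℝ) < n := by exact_mod_cast hn
  have hlog : 0 ≤ Real.log n := Real.log_natCast_nonneg n
  have hmem : (c : ℝ) * Real.log n ∈ freq 1 :=
    ⟨by positivity, n ^ c, 0, by positivity, by simp⟩
  have h1 := (HasExpansion.term (σ := τ) hmem ((n : ℂ) ^ (-c₁))).mul freq_nonneg
    ((hE.const_mul freq_nonneg (-(Real.log n : ℂ))).cexp freq_nonneg)
  -- The norm is a pure power of `n`, so it can be summed against the coefficients of a series in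
  -- `ℋ₊`.
  have hnorm : ‖(n : ℂ) ^ (-c₁)‖ * Real.exp (-((c : ℝ) * Real.log n * τ)) *
      Real.exp (‖-(Real.log n : ℂ)‖ * N) = (n : ℝ) ^ (-(c₁.re + c * τ - N)) := by
    rw [Complex.norm_natCast_cpow_of_pos hn, norm_neg, Complex.norm_real,
      Real.norm_of_nonneg hlog, Real.rpow_def_of_pos hn', Real.rpow_def_of_pos hn',
      ← Real.exp_add, ← Real.exp_add]
    congr 1
    rw [Complex.neg_re]
    ring
  rw [hnorm] at h1
  refine h1.congr fun s hs => ?_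
  rw [hφ s hs, natCast_cpow_eq_exp hn, natCast_cpow_eq_exp hn, ← Complex.exp_add,
    ← Complex.exp_add]
  congr 1
  push_cast
  ring

theorem coeff_eq_of_lSeries_eq {e e' : ℕ → ℂ} (h0 : e 0 = 0) (h0' : e' 0 = 0) {τ : ℝ}
    (h : ∀ s : ℂ, τ ≤ s.re → LSeriesSummable e s)
    (h' : ∀ s : ℂ, τ ≤ s.re → LSeriesSummable e' s)
    (heq : ∀ s : ℂ, τ ≤ s.re → LSeries e s = LSeries e' s) : e = e' := by
  ext n
  obtain rfl | hn := Nat.eq_zero_or_pos n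
  · rw [h0, h0']
  · refine LSeries.eq_of_LSeries_eventually_eq
      ((h τ (by simp)).abscissaOfAbsConv_le.trans_lt (EReal.coe_lt_top _))
      ((h' τ (by simp)).abscissaOfAbsConv_le.trans_lt (EReal.coe_lt_top _)) ?_ hn.ne'
    filter_upwards [eventually_ge_atTop τ] with x hx
    exact heq x (by simpa using hx)

theorem definesCompositionOperator_of_eq {θ : ℝ} {φ : ℂ → ℂ}
    (hφ : Set.MapsTo φ (halfPlane θ) (halfPlane (1 / 2))) {μ : ℝ} (hμ : θ ≤ μ) {c : ℕ} {a : ℕ → ℂ}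
    (ha0 : a 0 = 0)
    (ha : ∀ s ∈ halfPlane μ, HasSumAt a s (φ s - c * s)) : DefinesCompositionOperator θ φ := by
  have hL : ∀ s : ℂ, μ + 2 ≤ s.re → LSeriesSummable a s ∧ LSeries a s = φ s - c * s :=
    fun s hs => lSeries_eq_of_hasSumAt ha (by linarith)
  have hre : ∀ s : ℂ, μ + 2 ≤ s.re → 1 / 2 < (φ s).re := fun s hs =>
    hφ (show θ < s.re by linarith)
  -- Only `c = 0` uses the range of `φ`; for `c ≥ 1` the linear term exceeds any bound.
  obtain ⟨τ₀, hτ₀⟩ : ∃ τ₀ : ℝ, 1 / 2 < (a 1).re + c * τ₀ := by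
    obtain rfl | hc := Nat.eq_zero_or_pos c
    · refine ⟨0, ?_⟩
      simpa using lt_re_coeff_one ha0 (σ := μ + 2) (r := 1 / 2) fun s hs =>
        ⟨(hL s hs).1, by simpa [(hL s hs).2] using hre s hs⟩
    · refine ⟨1 + |(a 1).re|, ?_⟩
      have hc' : (1 : ℝ) ≤ c := by exact_mod_cast hc
      nlinarith [neg_abs_le (a 1).re, abs_nonneg (a 1).re]
  obtain ⟨M, hM⟩ := exists_hasExpansion_of_lSeriesSummable one_pos
    (fun k hk => by rw [Nat.lt_one_iff.mp hk, ha0]) (hL (μ + 2 : ℝ) (by simp)).1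
  obtain ⟨σ₀, hσ₀⟩ := hM.exists_lt (δ := Real.log ((1 : ℕ) + 1) - Real.log (1 : ℕ))
    (by simpa using Real.log_pos (by norm_num)) (fun x hx => hx.2) (sub_pos.mpr hτ₀)
  set τ := max (max σ₀ τ₀) (μ + 2)
  have hττ₀ : τ₀ ≤ τ := (le_max_right _ _).trans (le_max_left _ _)
  have hτμ : μ + 2 ≤ τ := le_max_right _ _
  obtain ⟨N, hN, hE⟩ := hσ₀ τ ((le_max_left _ _).trans (le_max_left _ _))
  have hX : 1 / 2 < (a 1).re + c * τ - N := by
    have := mul_le_mul_of_nonneg_left hττ₀ (Nat.cast_nonneg (α := ℝ) c)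
    linarith
  have hpow := fun n : ℕ => (hE.mono_freq Set.inter_subset_left).natCast_cpow (φ := φ) (c := c)
    (c₁ := a 1) (n := n) fun s hs => by
      rw [(hL s (hτμ.trans hs)).2]
      simp
  -- The half-plane `τ` does not depend on `b`, so the chosen coefficients can be compared on it,
  -- and uniqueness makes the map linear.
  have key : ∀ b : HPlus, ∃ e : ℕ → ℂ, e 0 = 0 ∧ ∀ s : ℂ, τ ≤ s.re →
      LSeriesSummable e s ∧ LSeries e s = LSeries b (φ s) := by
    rintro ⟨b, hb⟩
    have hexp : HasExpansion (freq 1) τ (fun s => LSeries b (φ s))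
        (∑' n : ℕ, ‖b n‖ * (n : ℝ) ^ (-((a 1).re + c * τ - N))) := by
      refine HasExpansion.hasSum (F := fun n s => b n * (n : ℂ) ^ (-φ s)) freq_nonneg (fun n => ?_)
        (summable_norm_mul_rpow_of_mem_HPlus hb hX).hasSum fun s hs => ?_
      · obtain rfl | hn := Nat.eq_zero_or_pos n
        · simpa [hb.1] using HasExpansion.const (σ := τ) (freq 1).zero_mem 0
        · exact (hpow n hn).const_mul freq_nonneg _
      · refine (hasSum_congr fun n => ?_).mp
          (lSeriesSummable_of_mem_HPlus hb (hre s (hτμ.trans hs))).hasSum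
        obtain rfl | hn := Nat.eq_zero_or_pos n
        · simp [hb.1]
        · rw [LSeries.term_of_ne_zero hn.ne', Complex.cpow_neg, div_eq_mul_inv]
    exact exists_lSeries_eq_of_hasExpansion hexp hexp
      fun x hx _ => exists_log_nat_of_mem_freq_one hx
  choose e he0 he using key
  have hsummable : ∀ (b : HPlus) (s : ℂ), τ ≤ s.re → LSeriesSummable (b : ℕ → ℂ) (φ s) :=
    fun b s hs => lSeriesSummable_of_mem_HPlus b.2 (hre s (hτμ.trans hs))
  refine ⟨{ toFun := fun b => ⟨e b, mem_D_of_lSeriesSummable (he0 b) (he b τ (by simp)).1⟩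
            map_add' := fun b b' => Subtype.ext ?_
            map_smul' := fun r b => Subtype.ext ?_ }, fun b => ⟨τ, by linarith, fun s hs => ?_⟩⟩
  · refine coeff_eq_of_lSeries_eq (τ := τ) (he0 _) (by simp [he0]) (fun s hs => (he _ s hs).1)
      (fun s hs => (he b s hs).1.add (he b' s hs).1) fun s hs => ?_
    change LSeries (e (b + b')) s = LSeries (e b + e b') s
    rw [(he _ s hs).2, LSeries_add (he b s hs).1 (he b' s hs).1, (he b s hs).2, (he b' s hs).2,
      ← LSeries_add (hsummable b s hs) (hsummable b' s hs)]
    rfl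
  · refine coeff_eq_of_lSeries_eq (τ := τ) (he0 _) (by simp [he0]) (fun s hs => (he _ s hs).1)
      (fun s hs => (he b s hs).1.smul r) fun s hs => ?_
    change LSeries (e (r • b)) s = LSeries (r • e b) s
    rw [(he _ s hs).2, LSeries_smul, (he b s hs).2, ← LSeries_smul]
    rfl
  · have hs' : τ ≤ s.re := le_of_lt hs
    refine ⟨LSeries b (φ s), hasSumAt_of_summable (hsummable b s hs'), ?_⟩
    rw [← (he b s hs').2]
    exact hasSumAt_of_summable (he b s hs').1

end DirichletSeries

theorem theorem4p1 (θ : ℝ) (φ : ℂ → ℂ)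
    (hφ : Set.MapsTo φ (DirichletSeries.halfPlane θ) (DirichletSeries.halfPlane (1 / 2))) :
    DirichletSeries.DefinesCompositionOperator θ φ ↔
      ∃ μ : ℝ, θ ≤ μ ∧ AnalyticOnNhd ℂ φ (DirichletSeries.halfPlane μ) ∧
        ∃ c₀ : ℕ, ∃ ϕ ∈ DirichletSeries.D, ∀ s ∈ DirichletSeries.halfPlane μ,
          ∃ v : ℂ, DirichletSeries.HasSumAt ϕ s v ∧ φ s = c₀ * s + v := by
  refine ⟨fun h => h.exists_eq, ?_⟩
  rintro ⟨μ, hμ, -, c, a, ha, h⟩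
  refine DirichletSeries.definesCompositionOperator_of_eq hφ hμ (c := c) ha.1 fun s hs => ?_
  obtain ⟨v, hv, hs⟩ := h s hs
  rwa [hs, add_sub_cancel_left]
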